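/- Consider finite or infinite sequences of pairs $(g_k,r_k)_{k\ge 1}$ of real numbers such that $0<g_k<1$ for all $k$, except that the last $g_n$ of a non-empty finite sequence is allowed to satisfy $0<g_n\le 1$; the empty sequence is included. To such a sequence associate the continued fraction $$ -\cfrac{1}{\lambda-\cfrac{g_1(\lambda^2+1)}{\lambda-r_1-\cfrac{(1-g_1)g_2(\lambda^2+1)}{\lambda-r_2-\cfrac{(1-g_2)g_3(\lambda^2+1)}{\lambda-r_3-\cdots}}}},\qquad \lambda\in\mathbb{C}_+=\{\lambda\in\mathbb C:\operatorname{Im}\lambda>0\}, $$ which terminates after the term containing $g_n$ and $r_n$ if the sequence has length $n$ (and is $-1/\lambda$ if the sequence is empty). The denominators of all approximants (given by the standard three-term recurrence) have no zeros in $\mathbb{C}_+$. If the sequence is infinite, the continued fraction converges locally uniformly in $\mathbb{C}_+$. Assigning to a sequence the value of its continued fraction (the limit of the approximants if the sequence is infinite) is a bijection from the set of all such sequences onto the set of all Nevanlinna functions $\varphi$ with $\varphi(i)=i$, where a Nevanlinna function is a holomorphic function on $\mathbb{C}_+$ with $\operatorname{Im}\varphi(\lambda)>0$ for all $\lambda\in\mathbb{C}_+$.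 -/

import Mathlib

open scoped UpperHalfPlane Manifold Topology

/-- The admissible (finite or infinite, possibly empty) sequences of pairs `(g₁, r₁), (g₂, r₂), …`
of real numbers: `0 < g_k < 1` for every `k`, except that the last `g_n` of a finite sequence
may also be equal to `1`. The entry with index `n` of the sequence is `(g_{n+1}, r_{n+1})`. -/
def WallParameters : Set (Stream'.Seq (ℝ × ℝ)) :=
  {p | ∀ (n : ℕ) (g r : ℝ), p.get? n = some (g, r) →
    0 < g ∧ (g < 1 ∨ (g = 1 ∧ p.TerminatedAt (n + 1)))}

/-- The Nevanlinna functions (holomorphic on the upper half-plane, with positive imaginary part)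
that are normalized by `φ(i) = i`. -/
def NormalizedNevanlinna : Set (ℍ → ℂ) :=
  {φ | MDifferentiable 𝓘(ℂ) 𝓘(ℂ) φ ∧ (∀ z : ℍ, 0 < (φ z).im) ∧ φ UpperHalfPlane.I = Complex.I}

/-- The continued fraction
`-1/(z - g₁(z²+1)/(z - r₁ - (1-g₁)g₂(z²+1)/(z - r₂ - (1-g₂)g₃(z²+1)/(z - r₃ - …))))`:
after the first term `-1/z`, the `k`-th term has the partial numerator
`-(1 - g_{k-1}) g_k (z² + 1)`, where `g₀ = 0`, and the partial denominator `z - r_k`. -/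
noncomputable def wallFraction (p : Stream'.Seq (ℝ × ℝ)) (z : ℂ) : GenContFract ℂ where
  h := 0
  s := Stream'.Seq.cons ⟨-1, z⟩
    (Stream'.Seq.zipWith
      (fun (g' : ℝ) (x : ℝ × ℝ) => ⟨-((1 - (g' : ℂ)) * (x.1 : ℂ) * (z ^ 2 + 1)), z - (x.2 : ℂ)⟩)
      (Stream'.Seq.cons 0 (p.map Prod.fst)) p)

/-!
The proof is the Schur algorithm, carried out on holomorphic self-maps `χ` of the upper half-plane
with `χ(i) = i`; the Nevanlinna function is `φ = -1/χ`.

*One step.* By Schwarz's lemma (`exists_eq_pickMap`), in disc coordinates centred at `i` such a `χ`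
is `w ↦ w f(w)` with `|f| ≤ 1`. On the half-plane this says `χ(z) = (z T(z) - 1) / (T(z) + z)`,
where `T` is the Cayley transform of `f`: either a function into the open upper half-plane or a real
constant, unless `χ` is the identity. Writing `T = ((1 - g) χ' - r) / g` with `χ'(i) = i` turns this
into one level of the continued fraction,
`χ(z) = z - g (z² + 1) / (z - r - (1 - g) (z - χ'(z)))` (`wallStep`). A real constant `T`
corresponds to `g = 1` and the identity to the end of the sequence. The value `T(i)` determines
`(g, r)`, so the expansion is unique (`wallLimit_injective`); at `i` itself the step is degenerate
and continuity is used.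

*Convergence.* For fixed `z` a step maps the half-plane into a compact hyperbolic disc and contracts
the pseudo-hyperbolic distance by the factor `|z² + 1| / (|z|² + 1) < 1`, whatever the parameters
(`wallStep_contract`). Hence compositions of `n` steps converge geometrically, with constants
continuous in `z`, and every `χ` is the limit of its own expansion (`wallLimit_wallExpansion`).

*Continuants.* The ratio of consecutive denominators obeys a recursion built from the same Möbius
transformation, so it stays in the upper half-plane (`wallFraction_dens_ratio`), and the
approximants of the continued fraction are the finite compositions of steps applied to `z`
(`wallFraction_convs_succ`).
-/

/-! ### The Möbius transformation behind one step -/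

/-- The Möbius transformation `T ↦ (z T - 1) / (T + z)` that carries one step of the expansion.
In the coordinate `(X - i) / (X + i)` on the upper half-plane it becomes
multiplication by `(z - i) / (z + i)`. -/
noncomputable def pickMap (z T : ℂ) : ℂ := (z * T - 1) / (T + z)

/-- The contraction factor of `pickMap z` for the pseudo-hyperbolic distance. -/
noncomputable def pickRate (z : ℂ) : ℝ := ‖z ^ 2 + 1‖ / (‖z‖ ^ 2 + 1)

lemma pickRate_nonneg (z : ℂ) : 0 ≤ pickRate z := by unfold pickRate; positivity

lemma pickRate_lt_one {z : ℂ} (hz : 0 < z.im) : pickRate z < 1 := by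
  unfold pickRate
  rw [div_lt_one (by positivity)]
  refine lt_of_pow_lt_pow_left₀ 2 (by positivity) ?_
  rw [Complex.sq_norm, Complex.sq_norm, Complex.normSq_apply, Complex.normSq_apply]
  simp only [pow_two, Complex.add_re, Complex.add_im, Complex.mul_re, Complex.mul_im,
    Complex.one_re, Complex.one_im]
  nlinarith [mul_pos hz hz]

lemma add_ne_zero_of_im {z T : ℂ} (hz : 0 < z.im) (hT : 0 ≤ T.im) : T + z ≠ 0 := by
  intro h
  have := congrArg Complex.im h
  simp at this
  linarith

lemma pickMap_im {z T : ℂ} (hz : 0 < z.im) (hT : 0 ≤ T.im) :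
    (pickMap z T).im * Complex.normSq (T + z) =
      (Complex.normSq z + 1) * T.im + z.im * (Complex.normSq T + 1) := by
  have h : Complex.normSq (T + z) ≠ 0 := by simpa using add_ne_zero_of_im hz hT
  unfold pickMap
  rw [Complex.div_im]
  field_simp
  simp [Complex.normSq_apply]
  ring

lemma pickMap_im_pos {z T : ℂ} (hz : 0 < z.im) (hT : 0 ≤ T.im) : 0 < (pickMap z T).im := by
  have h : 0 < Complex.normSq (T + z) := Complex.normSq_pos.2 (add_ne_zero_of_im hz hT)
  refine pos_of_mul_pos_left ?_ h.le
  rw [pickMap_im hz hT]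
  have := Complex.normSq_nonneg z
  have := Complex.normSq_nonneg T
  positivity

/-- The values of `pickMap z` lie in the hyperbolic disc around `i` of radius `dist z i`. -/
lemma pickMap_pick {z T : ℂ} (hz : 0 < z.im) (hT : 0 ≤ T.im) :
    z.im * (1 + Complex.normSq (pickMap z T)) ≤
      (pickMap z T).im * (1 + Complex.normSq z) := by
  have h : 0 < Complex.normSq (T + z) := Complex.normSq_pos.2 (add_ne_zero_of_im hz hT)
  refine le_of_mul_le_mul_right ?_ h
  have h1 : Complex.normSq (pickMap z T) * Complex.normSq (T + z) = Complex.normSq (z * T - 1) := by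
    unfold pickMap
    rw [Complex.normSq_div]
    field_simp
  have h2 := pickMap_im hz hT
  calc _ = z.im * (Complex.normSq (T + z) + Complex.normSq (pickMap z T) * Complex.normSq (T + z))
        := by ring
    _ ≤ ((pickMap z T).im * Complex.normSq (T + z)) * (1 + Complex.normSq z) := by
        rw [h1, h2]
        have : 0 ≤ T.im * ((z.re ^ 2 + z.im ^ 2 + 1) ^ 2 - 4 * z.im ^ 2) := by
          refine mul_nonneg hT ?_
          nlinarith [sq_nonneg (z.re ^ 2 + z.im ^ 2 - 1), sq_nonneg z.re]
        simp only [Complex.normSq_apply, Complex.add_re, Complex.add_im, Complex.mul_re,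
          Complex.mul_im, Complex.one_re, Complex.one_im, Complex.sub_re, Complex.sub_im]
        nlinarith
    _ = _ := by ring

/-- `pickMap z` contracts the pseudo-hyperbolic distance `|T - T'| / |T - conj T'|` by the factor
`pickRate z`, which is the gain from shrinking the unit disc by a factor less than one. -/
lemma pickMap_contract {z T T' : ℂ} {c : ℝ} (hz : 0 < z.im) (hT : 0 ≤ T.im) (hT' : 0 ≤ T'.im)
    (hc : 0 ≤ c) (h : ‖T - T'‖ ≤ c * ‖T - (starRingEnd ℂ) T'‖) :
    ‖pickMap z T - pickMap z T'‖ ≤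
      pickRate z * c * ‖pickMap z T - (starRingEnd ℂ) (pickMap z T')‖ := by
  have h1 := add_ne_zero_of_im hz hT
  have h2 := add_ne_zero_of_im hz hT'
  have h2' : (starRingEnd ℂ) (T' + z) ≠ 0 := (map_ne_zero _).2 h2
  have e1 : (pickMap z T - pickMap z T') * ((T + z) * (T' + z)) = (z ^ 2 + 1) * (T - T') := by
    unfold pickMap; field_simp; ring
  set A := T - (starRingEnd ℂ) T' with hA
  set B := Complex.I * (T * (starRingEnd ℂ) T' + 1) with hB
  have e2 : (pickMap z T - (starRingEnd ℂ) (pickMap z T')) *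
      ((T + z) * (starRingEnd ℂ) (T' + z)) =
      ((Complex.normSq z + 1 : ℝ) : ℂ) * A + ((2 * z.im : ℝ) : ℂ) * B := by
    have : (pickMap z T - (starRingEnd ℂ) (pickMap z T')) *
      ((T + z) * (starRingEnd ℂ) (T' + z)) = (z * T - 1) * (starRingEnd ℂ) (T' + z) -
        (T + z) * (starRingEnd ℂ) (z * T' - 1) := by
      unfold pickMap; rw [map_div₀]; field_simp
    rw [this, hA, hB]
    apply Complex.ext <;> simp [Complex.normSq_apply] <;> ring
  -- the two summands of `e2` make an acute angle
  have acute : 0 ≤ A.re * B.re + A.im * B.im := by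
    have : A.re * B.re + A.im * B.im = Complex.normSq T * T'.im + T.im
        + Complex.normSq T' * T.im + T'.im := by
      simp [hA, hB, Complex.normSq_apply]; ring
    rw [this]
    have := Complex.normSq_nonneg T
    have := Complex.normSq_nonneg T'
    positivity
  have e3 : (‖z‖ ^ 2 + 1) * ‖A‖ ≤ ‖((Complex.normSq z + 1 : ℝ) : ℂ) * A +
      ((2 * z.im : ℝ) : ℂ) * B‖ := by
    refine le_of_sq_le_sq ?_ (norm_nonneg _)
    have hn := Complex.normSq_nonneg z
    rw [mul_pow, Complex.sq_norm, Complex.sq_norm, Complex.sq_norm]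
    set s := Complex.normSq z
    simp only [Complex.normSq_apply A, Complex.normSq_apply (_ + _), Complex.add_re, Complex.add_im,
      Complex.re_ofReal_mul, Complex.im_ofReal_mul]
    have := mul_nonneg (mul_nonneg (by positivity : 0 ≤ s + 1) hz.le) acute
    nlinarith [sq_nonneg (z.im * B.re), sq_nonneg (z.im * B.im)]
  have hD : 0 < ‖(T + z) * (T' + z)‖ := norm_pos_iff.2 (mul_ne_zero h1 h2)
  refine le_of_mul_le_mul_right ?_ hD
  have hD' : ‖(T + z) * (T' + z)‖ = ‖(T + z) * (starRingEnd ℂ) (T' + z)‖ := by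
    rw [norm_mul, norm_mul, Complex.norm_conj]
  rw [← norm_mul, e1, mul_assoc (pickRate z * c), hD', ← norm_mul, e2, norm_mul]
  calc ‖z ^ 2 + 1‖ * ‖T - T'‖ ≤ ‖z ^ 2 + 1‖ * (c * ‖A‖) := by gcongr
    _ = pickRate z * c * ((‖z‖ ^ 2 + 1) * ‖A‖) := by
        unfold pickRate; field_simp
    _ ≤ _ := mul_le_mul_of_nonneg_left e3 (mul_nonneg (pickRate_nonneg z) hc)

/-! ### Hyperbolic discs around `i` -/

/-- The closed hyperbolic disc around `i` through `z`. -/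
def pickDisc (z : ℂ) : Set ℂ :=
  {X | z.im * (1 + Complex.normSq X) ≤ X.im * (1 + Complex.normSq z)}

lemma self_mem_pickDisc (z : ℂ) : z ∈ pickDisc z :=
  le_refl (z.im * (1 + Complex.normSq z))

lemma isClosed_pickDisc (z : ℂ) : IsClosed (pickDisc z) :=
  isClosed_le (by fun_prop) (by fun_prop)

lemma im_pos_of_mem_pickDisc {z X : ℂ} (hz : 0 < z.im) (hX : X ∈ pickDisc z) : 0 < X.im := by
  have h1 := Complex.normSq_nonneg X
  have h2 := Complex.normSq_nonneg z
  exact pos_of_mul_pos_left (lt_of_lt_of_le (by positivity) hX) (by positivity)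

/-- A bound for `‖X‖` and `‖X⁻¹‖` when `X ∈ pickDisc z`. -/
noncomputable def pickBound (z : ℂ) : ℝ := (1 + Complex.normSq z) / z.im

lemma norm_le_pickBound {z X : ℂ} (hz : 0 < z.im) (hX : X ∈ pickDisc z) : ‖X‖ ≤ pickBound z := by
  have h0 := norm_pos_iff.2 (fun h : X = 0 => by
    simpa [h] using im_pos_of_mem_pickDisc hz hX)
  have h1 : z.im * (1 + Complex.normSq X) ≤ X.im * (1 + Complex.normSq z) := hX
  rw [pickBound, le_div_iff₀ hz]
  refine le_of_mul_le_mul_right ?_ h0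
  have h2 := Complex.im_le_norm X
  have h3 := Complex.normSq_nonneg z
  rw [Complex.normSq_eq_norm_sq X] at h1
  nlinarith

lemma norm_inv_le_pickBound {z X : ℂ} (hz : 0 < z.im) (hX : X ∈ pickDisc z) :
    ‖X⁻¹‖ ≤ pickBound z := by
  have h0 := norm_pos_iff.2 (fun h : X = 0 => by
    simpa [h] using im_pos_of_mem_pickDisc hz hX)
  have h1 : z.im * (1 + Complex.normSq X) ≤ X.im * (1 + Complex.normSq z) := hX
  rw [pickBound, le_div_iff₀ hz, norm_inv, ← div_eq_inv_mul, div_le_iff₀ h0]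
  have h2 := Complex.im_le_norm X
  have h3 := Complex.normSq_nonneg z
  have h4 := Complex.normSq_nonneg X
  nlinarith

/-! ### One step of the expansion -/

/-- One step of the expansion: with `X` standing for the rest of the continued fraction,
`some (g, r)` gives the next level, and `none` terminates with the value `z`. -/
noncomputable def wallStep (z : ℂ) : Option (ℝ × ℝ) → ℂ → ℂ
  | none, _ => z
  | some (g, r), X => z - g * (z ^ 2 + 1) / (z - r - (1 - g) * (z - X))

lemma affine_im_nonneg {g r : ℝ} {X : ℂ} (hg : 0 < g) (hg1 : g ≤ 1) (hX : 0 ≤ X.im) :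
    0 ≤ (((1 - g) * X - r) / g : ℂ).im := by
  rw [Complex.div_ofReal_im]
  have : (((1 - g) * X - r : ℂ)).im = (1 - g) * X.im := by simp
  rw [this]
  have : 0 ≤ 1 - g := by linarith
  positivity

lemma wallStep_some {z X : ℂ} {g r : ℝ} (hz : 0 < z.im) (hg : 0 < g) (hg1 : g ≤ 1)
    (hX : 0 ≤ X.im) :
    wallStep z (some (g, r)) X = pickMap z (((1 - g) * X - r) / g) := by
  have h := add_ne_zero_of_im hz (affine_im_nonneg (r := r) hg hg1 hX)
  have hg' : (g : ℂ) ≠ 0 := by exact_mod_cast hg.ne'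
  have e : z - r - (1 - g) * (z - X) = g * (((1 - g) * X - r) / g + z) := by field_simp; ring
  simp only [wallStep, pickMap]
  rw [e, mul_div_mul_left _ _ hg', eq_div_iff h, sub_mul, div_mul_cancel₀ _ h]
  ring

lemma wallStep_den_ne_zero {z X : ℂ} {g r : ℝ} (hz : 0 < z.im) (hg : 0 < g) (hg1 : g ≤ 1)
    (hX : 0 ≤ X.im) : z - r - (1 - g) * (z - X) ≠ 0 := by
  intro h
  have := congrArg Complex.im h
  simp at this
  nlinarith [mul_pos hg hz]

lemma wallStep_mem_pickDisc {z X : ℂ} {o : Option (ℝ × ℝ)} (hz : 0 < z.im)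
    (ho : ∀ x ∈ o, 0 < x.1 ∧ x.1 ≤ 1) (hX : 0 ≤ X.im) : wallStep z o X ∈ pickDisc z := by
  rcases o with _ | ⟨g, r⟩
  · exact self_mem_pickDisc z
  · obtain ⟨hg, hg1⟩ := ho (g, r) rfl
    rw [wallStep_some hz hg hg1 hX]
    exact pickMap_pick hz (affine_im_nonneg hg hg1 hX)

lemma wallStep_contract {z X Y : ℂ} {o : Option (ℝ × ℝ)} {c : ℝ} (hz : 0 < z.im)
    (ho : ∀ x ∈ o, 0 < x.1 ∧ x.1 ≤ 1) (hX : 0 ≤ X.im) (hY : 0 ≤ Y.im) (hc : 0 ≤ c)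
    (h : ‖X - Y‖ ≤ c * ‖X - (starRingEnd ℂ) Y‖) :
    ‖wallStep z o X - wallStep z o Y‖ ≤
      pickRate z * c * ‖wallStep z o X - (starRingEnd ℂ) (wallStep z o Y)‖ := by
  rcases o with _ | ⟨g, r⟩
  · simp only [wallStep, sub_self, norm_zero]
    exact mul_nonneg (mul_nonneg (pickRate_nonneg z) hc) (norm_nonneg _)
  · obtain ⟨hg, hg1⟩ := ho (g, r) rfl
    simp only at hg hg1
    rw [wallStep_some hz hg hg1 hX, wallStep_some hz hg hg1 hY]
    refine pickMap_contract hz (affine_im_nonneg hg hg1 hX) (affine_im_nonneg hg hg1 hY) hc ?_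
    have e1 : ((1 - g) * X - r) / g - ((1 - g) * Y - r) / g = (((1 - g) / g : ℝ) : ℂ) * (X - Y) := by
      push_cast; ring
    have e2 : ((1 - g) * X - r) / g - (starRingEnd ℂ) (((1 - g) * Y - r) / g) =
        (((1 - g) / g : ℝ) : ℂ) * (X - (starRingEnd ℂ) Y) := by
      simp only [map_div₀, map_sub, map_mul, map_one, Complex.conj_ofReal]
      push_cast; ring
    rw [e1, e2, norm_mul, norm_mul]
    nlinarith [mul_le_mul_of_nonneg_left h (norm_nonneg (((1 - g) / g : ℝ) : ℂ))]

lemma continuousAt_wallStep {z X : ℂ} {o : Option (ℝ × ℝ)} (hz : 0 < z.im)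
    (ho : ∀ x ∈ o, 0 < x.1 ∧ x.1 ≤ 1) (hX : 0 ≤ X.im) : ContinuousAt (wallStep z o) X := by
  rcases o with _ | ⟨g, r⟩
  · exact continuousAt_const
  · obtain ⟨hg, hg1⟩ := ho (g, r) rfl
    exact continuousAt_const.sub
      (continuousAt_const.div (by fun_prop) (wallStep_den_ne_zero hz hg hg1 hX))

lemma differentiableOn_wallStep {F : ℂ → ℂ} {o : Option (ℝ × ℝ)}
    (ho : ∀ x ∈ o, 0 < x.1 ∧ x.1 ≤ 1) (hF : DifferentiableOn ℂ F {z | 0 < z.im})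
    (hF0 : ∀ z : ℂ, 0 < z.im → 0 < (F z).im) :
    DifferentiableOn ℂ (fun z => wallStep z o (F z)) {z | 0 < z.im} := by
  rcases o with _ | ⟨g, r⟩
  · exact differentiableOn_id
  · obtain ⟨hg, hg1⟩ := ho (g, r) rfl
    exact differentiableOn_id.sub (DifferentiableOn.div (by fun_prop) (by fun_prop)
      fun z hz => wallStep_den_ne_zero hz hg hg1 (hF0 z hz).le)

/-! ### Iterated steps and their limit -/

/-- The composition of the first `n` steps of the expansion, applied to `X`. -/
noncomputable def wallTail (p : Stream'.Seq (ℝ × ℝ)) (z : ℂ) : ℕ → ℂ → ℂ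
  | 0, X => X
  | n + 1, X => wallTail p z n (wallStep z (p.get? n) X)

/-- All first components lie in `(0, 1]`; unlike membership in `WallParameters`, this does not
ask that a component equal to `1` be the last. -/
def WallBounded (p : Stream'.Seq (ℝ × ℝ)) : Prop := ∀ n, ∀ x ∈ p.get? n, 0 < x.1 ∧ x.1 ≤ 1

lemma WallBounded.tail {p : Stream'.Seq (ℝ × ℝ)} (hp : WallBounded p) : WallBounded p.tail :=
  fun n => by simpa only [Stream'.Seq.get?_tail] using hp (n + 1)

lemma wallTail_succ' (p : Stream'.Seq (ℝ × ℝ)) (z X : ℂ) (n : ℕ) :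
    wallTail p z (n + 1) X = wallStep z (p.get? 0) (wallTail p.tail z n X) := by
  induction n generalizing X with
  | zero => rfl
  | succ n ih => rw [wallTail, ih, wallTail, Stream'.Seq.get?_tail]

lemma wallTail_im_pos {p : Stream'.Seq (ℝ × ℝ)} {z X : ℂ} (hp : WallBounded p) (hz : 0 < z.im)
    (hX : 0 < X.im) (n : ℕ) : 0 < (wallTail p z n X).im := by
  induction n generalizing X with
  | zero => exact hX
  | succ n ih => exact ih (im_pos_of_mem_pickDisc hz (wallStep_mem_pickDisc hz (hp n) hX.le))

lemma wallTail_mem_pickDisc {p : Stream'.Seq (ℝ × ℝ)} {z X : ℂ} (hp : WallBounded p)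
    (hz : 0 < z.im) (hX : X ∈ pickDisc z) (n : ℕ) : wallTail p z n X ∈ pickDisc z := by
  induction n generalizing X with
  | zero => exact hX
  | succ n ih => exact ih (wallStep_mem_pickDisc hz (hp n) (im_pos_of_mem_pickDisc hz hX).le)

lemma wallTail_contract {p : Stream'.Seq (ℝ × ℝ)} {z X Y : ℂ} (hp : WallBounded p)
    (hz : 0 < z.im) (hX : 0 < X.im) (hY : 0 < Y.im) (n : ℕ) :
    ‖wallTail p z n X - wallTail p z n Y‖ ≤
      pickRate z ^ n * ‖wallTail p z n X - (starRingEnd ℂ) (wallTail p z n Y)‖ := by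
  induction n generalizing p with
  | zero =>
    simp only [wallTail, pow_zero, one_mul]
    refine le_of_sq_le_sq ?_ (norm_nonneg _)
    rw [Complex.sq_norm, Complex.sq_norm, Complex.normSq_apply, Complex.normSq_apply]
    simp
    nlinarith [mul_pos hX hY]
  | succ n ih =>
    rw [wallTail_succ', wallTail_succ', pow_succ']
    exact wallStep_contract hz (hp 0) (wallTail_im_pos hp.tail hz hX n).le
      (wallTail_im_pos hp.tail hz hY n).le (pow_nonneg (pickRate_nonneg z) n) (ih hp.tail)

lemma norm_wallTail_sub_le {p : Stream'.Seq (ℝ × ℝ)} {z X Y : ℂ} (hp : WallBounded p)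
    (hz : 0 < z.im) (hX : X ∈ pickDisc z) (hY : Y ∈ pickDisc z) (n : ℕ) :
    ‖wallTail p z n X - wallTail p z n Y‖ ≤ 2 * pickBound z * pickRate z ^ n := by
  refine (wallTail_contract hp hz (im_pos_of_mem_pickDisc hz hX)
    (im_pos_of_mem_pickDisc hz hY) n).trans ?_
  rw [mul_comm]
  refine mul_le_mul_of_nonneg_right ?_ (pow_nonneg (pickRate_nonneg z) n)
  refine (norm_sub_le _ _).trans ?_
  rw [Complex.norm_conj, two_mul]
  exact add_le_add (norm_le_pickBound hz (wallTail_mem_pickDisc hp hz hX n))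
    (norm_le_pickBound hz (wallTail_mem_pickDisc hp hz hY n))

lemma norm_inv_wallTail_sub_le {p : Stream'.Seq (ℝ × ℝ)} {z X Y : ℂ} (hp : WallBounded p)
    (hz : 0 < z.im) (hX : X ∈ pickDisc z) (hY : Y ∈ pickDisc z) (n : ℕ) :
    ‖(wallTail p z n X)⁻¹ - (wallTail p z n Y)⁻¹‖ ≤ 2 * pickBound z * pickRate z ^ n := by
  have h := wallTail_contract hp hz (im_pos_of_mem_pickDisc hz hX)
    (im_pos_of_mem_pickDisc hz hY) n
  have hA := wallTail_mem_pickDisc hp hz hX n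
  have hB := wallTail_mem_pickDisc hp hz hY n
  set A := wallTail p z n X
  set B := wallTail p z n Y
  have hA0 : A ≠ 0 := fun h => by simpa [h] using im_pos_of_mem_pickDisc hz hA
  have hB0 : B ≠ 0 := fun h => by simpa [h] using im_pos_of_mem_pickDisc hz hB
  have hB0' : (starRingEnd ℂ) B ≠ 0 := (map_ne_zero _).2 hB0
  have e1 : ‖A⁻¹ - B⁻¹‖ = ‖A - B‖ * (‖A‖ * ‖B‖)⁻¹ := by
    rw [inv_sub_inv hA0 hB0, norm_div, norm_mul, norm_sub_rev, div_eq_mul_inv]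
  have e2 : ‖A - (starRingEnd ℂ) B‖ * (‖A‖ * ‖B‖)⁻¹ = ‖A⁻¹ - (starRingEnd ℂ) B⁻¹‖ := by
    rw [map_inv₀, inv_sub_inv hA0 hB0', norm_div, norm_mul, norm_sub_rev, div_eq_mul_inv,
      Complex.norm_conj]
  rw [e1]
  calc _ ≤ pickRate z ^ n * ‖A - (starRingEnd ℂ) B‖ * (‖A‖ * ‖B‖)⁻¹ := by gcongr
    _ = ‖A⁻¹ - (starRingEnd ℂ) B⁻¹‖ * pickRate z ^ n := by rw [mul_assoc, e2, mul_comm]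
    _ ≤ _ := by
      refine mul_le_mul_of_nonneg_right ?_ (pow_nonneg (pickRate_nonneg z) n)
      refine (norm_sub_le _ _).trans ?_
      rw [Complex.norm_conj, two_mul]
      exact add_le_add (norm_inv_le_pickBound hz hA) (norm_inv_le_pickBound hz hB)

/-- The value of the infinite composition of steps. For a terminating sequence the approximants are
eventually constant, so this is also the value of the finite expansion. -/
noncomputable def wallLimit (p : Stream'.Seq (ℝ × ℝ)) (z : ℂ) : ℂ :=
  Filter.limUnder Filter.atTop (fun n => wallTail p z n z)

lemma tendsto_wallTail {p : Stream'.Seq (ℝ × ℝ)} {z : ℂ} (hp : WallBounded p) (hz : 0 < z.im) :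
    Filter.Tendsto (fun n => wallTail p z n z) Filter.atTop (𝓝 (wallLimit p z)) := by
  refine CauchySeq.tendsto_limUnder (cauchySeq_of_le_geometric (pickRate z) (2 * pickBound z)
    (pickRate_lt_one hz) fun n => ?_)
  rw [dist_eq_norm]
  exact norm_wallTail_sub_le hp hz (self_mem_pickDisc z)
    (wallStep_mem_pickDisc hz (hp n) hz.le) n

lemma wallLimit_mem_pickDisc {p : Stream'.Seq (ℝ × ℝ)} {z : ℂ} (hp : WallBounded p)
    (hz : 0 < z.im) : wallLimit p z ∈ pickDisc z :=
  (isClosed_pickDisc z).mem_of_tendsto (tendsto_wallTail hp hz)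
    (Filter.Eventually.of_forall (wallTail_mem_pickDisc hp hz (self_mem_pickDisc z)))

lemma wallLimit_im_pos {p : Stream'.Seq (ℝ × ℝ)} {z : ℂ} (hp : WallBounded p)
    (hz : 0 < z.im) : 0 < (wallLimit p z).im :=
  im_pos_of_mem_pickDisc hz (wallLimit_mem_pickDisc hp hz)

lemma wallLimit_eq_wallStep {p : Stream'.Seq (ℝ × ℝ)} {z : ℂ} (hp : WallBounded p)
    (hz : 0 < z.im) : wallLimit p z = wallStep z (p.get? 0) (wallLimit p.tail z) := by
  refine tendsto_nhds_unique ((Filter.tendsto_add_atTop_iff_nat 1).2 (tendsto_wallTail hp hz)) ?_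
  simp only [wallTail_succ']
  exact (continuousAt_wallStep hz (hp 0) (wallLimit_im_pos hp.tail hz).le).tendsto.comp
    (tendsto_wallTail hp.tail hz)

lemma exists_wallLimit_eq_wallTail {p : Stream'.Seq (ℝ × ℝ)} {z : ℂ} (hp : WallBounded p)
    (hz : 0 < z.im) (n : ℕ) : ∃ X ∈ pickDisc z, wallLimit p z = wallTail p z n X := by
  induction n generalizing p with
  | zero => exact ⟨_, wallLimit_mem_pickDisc hp hz, rfl⟩
  | succ n ih =>
    obtain ⟨X, hX, h⟩ := ih hp.tail
    exact ⟨X, hX, by rw [wallLimit_eq_wallStep hp hz, h, wallTail_succ']⟩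

lemma wallLimit_I {p : Stream'.Seq (ℝ × ℝ)} (hp : WallBounded p) :
    wallLimit p Complex.I = Complex.I := by
  rw [wallLimit_eq_wallStep hp (by simp)]
  rcases p.get? 0 with _ | ⟨g, r⟩ <;> simp [wallStep]

lemma differentiableOn_wallTail {p : Stream'.Seq (ℝ × ℝ)} (hp : WallBounded p) (n : ℕ) :
    DifferentiableOn ℂ (fun z => wallTail p z n z) {z | 0 < z.im} := by
  induction n generalizing p with
  | zero => exact differentiableOn_id
  | succ n ih =>
    simp only [wallTail_succ']
    exact differentiableOn_wallStep (hp 0) (ih hp.tail)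
      fun z hz => wallTail_im_pos hp.tail hz hz n

/-- Geometric convergence with continuous constant and continuous rate is locally uniform. -/
lemma tendstoLocallyUniformlyOn_of_norm_sub_le_geometric {U : Set ℂ} {F : ℕ → ℂ → ℂ} {f : ℂ → ℂ}
    {C q : ℂ → ℝ} (hC : ContinuousOn C U) (hq : ContinuousOn q U) (hq0 : ∀ z ∈ U, 0 ≤ q z)
    (hq1 : ∀ z ∈ U, q z < 1) (h : ∀ n, ∀ z ∈ U, ‖F n z - f z‖ ≤ C z * q z ^ n) :
    TendstoLocallyUniformlyOn F f Filter.atTop U := by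
  rw [Metric.tendstoLocallyUniformlyOn_iff]
  intro ε hε x hx
  obtain ⟨s, hs1, hs2⟩ := exists_between (hq1 x hx)
  have hs0 : 0 ≤ s := (hq0 x hx).trans hs1.le
  refine ⟨{y | y ∈ U ∧ q y < s ∧ C y < |C x| + 1}, ?_, ?_⟩
  · filter_upwards [self_mem_nhdsWithin, (hq x hx).eventually_lt_const hs1,
      (hC x hx).eventually_lt_const (lt_of_le_of_lt (le_abs_self _) (lt_add_one _))]
      with y h1 h2 h3 using ⟨h1, h2, h3⟩
  · have ht : Filter.Tendsto (fun n => (|C x| + 1) * s ^ n) Filter.atTop (𝓝 0) := by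
      simpa using (tendsto_pow_atTop_nhds_zero_of_lt_one hs0 hs2).const_mul (|C x| + 1)
    filter_upwards [ht.eventually_lt_const hε] with n hn y hy
    rw [dist_comm, dist_eq_norm]
    refine lt_of_le_of_lt ((h n y hy.1).trans ?_) hn
    have := hq0 y hy.1
    exact mul_le_mul hy.2.2.le (pow_le_pow_left₀ this hy.2.1.le n) (by positivity) (by positivity)

lemma tendstoLocallyUniformlyOn_inv_wallTail {p : Stream'.Seq (ℝ × ℝ)} (hp : WallBounded p) :
    TendstoLocallyUniformlyOn (fun n z => -(wallTail p z n z)⁻¹) (fun z => -(wallLimit p z)⁻¹)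
      Filter.atTop {z | 0 < z.im} := by
  refine tendstoLocallyUniformlyOn_of_norm_sub_le_geometric (C := fun z => 2 * pickBound z)
    (q := pickRate) ?_ ?_ (fun z _ => pickRate_nonneg z) (fun z hz => pickRate_lt_one hz) ?_
  · unfold pickBound
    exact continuousOn_const.mul (ContinuousOn.div (by fun_prop) (by fun_prop)
      fun z hz => ne_of_gt hz)
  · unfold pickRate
    exact ContinuousOn.div (by fun_prop) (by fun_prop) fun z _ => by positivity
  · intro n z hz
    obtain ⟨X, hX, h⟩ := exists_wallLimit_eq_wallTail hp hz n
    rw [h, neg_sub_neg]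
    exact norm_inv_wallTail_sub_le hp hz hX (self_mem_pickDisc z) n

lemma differentiableOn_inv_wallLimit {p : Stream'.Seq (ℝ × ℝ)} (hp : WallBounded p) :
    DifferentiableOn ℂ (fun z => -(wallLimit p z)⁻¹) {z | 0 < z.im} := by
  refine (tendstoLocallyUniformlyOn_inv_wallTail hp).differentiableOn
    (Filter.Eventually.of_forall fun n => ?_) (isOpen_lt continuous_const Complex.continuous_im)
  refine ((differentiableOn_wallTail hp n).inv fun z hz h => ?_).neg
  simpa [h] using wallTail_im_pos hp hz hz n

/-! ### The continuants of the continued fraction -/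

lemma wallParameters_bounded {p : Stream'.Seq (ℝ × ℝ)} (hp : p ∈ WallParameters) :
    WallBounded p := by
  rintro n ⟨g, r⟩ hx
  obtain ⟨h0, h | ⟨h, -⟩⟩ := hp n g r hx
  · exact ⟨h0, h.le⟩
  · exact ⟨h0, h.le⟩

lemma wallParameters_lt_one {p : Stream'.Seq (ℝ × ℝ)} (hp : p ∈ WallParameters) {n : ℕ} {g r : ℝ}
    (h : p.get? n = some (g, r)) {x : ℝ × ℝ} (h' : p.get? (n + 1) = some x) : g < 1 := by
  obtain ⟨-, h1 | ⟨-, h1⟩⟩ := hp n g r h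
  · exact h1
  · rw [Stream'.Seq.TerminatedAt, h'] at h1
    simp at h1

/-- The sequence `0, g₁, g₂, …` of the first components, shifted by one place. -/
def shiftedFst (p : Stream'.Seq (ℝ × ℝ)) : Stream'.Seq ℝ :=
  Stream'.Seq.cons 0 (p.map Prod.fst)

lemma shiftedFst_succ (p : Stream'.Seq (ℝ × ℝ)) (n : ℕ) :
    (shiftedFst p).get? (n + 1) = (p.get? n).map Prod.fst := by
  rw [shiftedFst, Stream'.Seq.get?_cons_succ, Stream'.Seq.map_get?]

lemma wallFraction_get?_succ {p : Stream'.Seq (ℝ × ℝ)} (z : ℂ) {n : ℕ} {g' g r : ℝ}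
    (h' : (shiftedFst p).get? n = some g') (h : p.get? n = some (g, r)) :
    (wallFraction p z).s.get? (n + 1) =
      some ⟨-((1 - (g' : ℂ)) * (g : ℂ) * (z ^ 2 + 1)), z - (r : ℂ)⟩ := by
  rw [shiftedFst] at h'
  simp [wallFraction, Stream'.Seq.get?_zipWith, h, h']

lemma wallFraction_terminatedAt {p : Stream'.Seq (ℝ × ℝ)} (z : ℂ) {n : ℕ}
    (h : p.get? n = none) : (wallFraction p z).TerminatedAt (n + 1) := by
  rw [GenContFract.terminatedAt_iff_s_none]
  simp [wallFraction, Stream'.Seq.get?_zipWith, h]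

lemma wallFraction_nums_zero (p : Stream'.Seq (ℝ × ℝ)) (z : ℂ) : (wallFraction p z).nums 0 = 0 := by
  simp [wallFraction]

lemma wallFraction_nums_one (p : Stream'.Seq (ℝ × ℝ)) (z : ℂ) : (wallFraction p z).nums 1 = -1 := by
  rw [GenContFract.first_num_eq (gp := ⟨-1, z⟩) rfl]
  simp [wallFraction]

lemma wallFraction_dens_one (p : Stream'.Seq (ℝ × ℝ)) (z : ℂ) : (wallFraction p z).dens 1 = z :=
  GenContFract.first_den_eq (gp := ⟨-1, z⟩) rfl

/-- For `p.get? n = some _` the predecessor in `shiftedFst` exists and is less than one. -/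
lemma exists_shiftedFst {p : Stream'.Seq (ℝ × ℝ)} (hp : p ∈ WallParameters) {n : ℕ} {x : ℝ × ℝ}
    (h : p.get? n = some x) : ∃ g', (shiftedFst p).get? n = some g' ∧ g' < 1 := by
  rcases n with _ | n
  · exact ⟨0, rfl, one_pos⟩
  · obtain ⟨⟨g, r⟩, h2⟩ := p.ge_stable (Nat.le_succ n) h
    exact ⟨g, by rw [shiftedFst_succ, h2]; rfl, wallParameters_lt_one hp h2 h⟩

/-- The ratio of consecutive denominators again satisfies a recursion of the type `pickMap`: if
`D_{n+1} / D_n = (1 - g_n) (z + v)`, then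
`D_{n+2} / D_{n+1} = (1 - g_{n+1}) z - r_{n+1} + g_{n+1} pickMap z v`.
Hence `Im v ≥ 0` propagates, and no denominator vanishes. -/
lemma wallFraction_dens_ratio {p : Stream'.Seq (ℝ × ℝ)} (hp : p ∈ WallParameters) {z : ℂ}
    (hz : 0 < z.im) (n : ℕ) {g' : ℝ} (h : (shiftedFst p).get? n = some g') :
    (wallFraction p z).dens n ≠ 0 ∧ (wallFraction p z).dens (n + 1) ≠ 0 ∧
      (1 - g') * z.im ≤ ((wallFraction p z).dens (n + 1) / (wallFraction p z).dens n).im := by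
  induction n generalizing g' with
  | zero =>
    have h0 : g' = 0 := by simpa [shiftedFst, eq_comm] using h
    rw [wallFraction_dens_one, GenContFract.zeroth_den_eq_one, h0]
    refine ⟨one_ne_zero, fun h => by simp [h] at hz, by simp⟩
  | succ n ih =>
    rw [shiftedFst_succ, Option.map_eq_some_iff] at h
    obtain ⟨⟨g, r⟩, hn, rfl⟩ := h
    obtain ⟨b, hb, hb1⟩ := exists_shiftedFst hp hn
    obtain ⟨d0, d1, hq⟩ := ih hb
    obtain ⟨hg, hg1⟩ := wallParameters_bounded hp n _ hn
    simp only at hg hg1 ⊢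
    have hrec := GenContFract.dens_recurrence (wallFraction_get?_succ z hb hn) rfl rfl
    set D0 := (wallFraction p z).dens n
    set D1 := (wallFraction p z).dens (n + 1)
    have hb' : (1 - (b : ℂ)) ≠ 0 := by
      have : (1 - b : ℝ) ≠ 0 := by linarith
      exact_mod_cast this
    set v := D1 / D0 / (1 - (b : ℂ)) - z with hv
    have hvim : 0 ≤ v.im := by
      have e : (1 - (b : ℂ)) = ((1 - b : ℝ) : ℂ) := by push_cast; rfl
      rw [hv, Complex.sub_im, e, Complex.div_ofReal_im, sub_nonneg, le_div_iff₀ (by linarith)]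
      linarith
    have hvz := add_ne_zero_of_im hz hvim
    have key : (wallFraction p z).dens (n + 2) / D1 =
        ((1 - g : ℝ) : ℂ) * z - r + (g : ℂ) * pickMap z v := by
      have e : D1 = D0 * ((1 - (b : ℂ)) * (v + z)) := by rw [hv]; field_simp; ring
      rw [hrec, add_div, mul_div_cancel_right₀ _ d1, e, pickMap]
      push_cast
      field_simp
      ring
    have him : ((wallFraction p z).dens (n + 2) / D1).im =
        (1 - g) * z.im + g * (pickMap z v).im := by
      rw [key, Complex.add_im, Complex.sub_im, Complex.im_ofReal_mul, Complex.im_ofReal_mul]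
      simp
    have hpos := mul_pos hg (pickMap_im_pos hz hvim)
    refine ⟨d1, fun h0 => ?_, ?_⟩
    · rw [h0, zero_div, Complex.zero_im] at him
      nlinarith
    · rw [him]
      linarith

lemma wallFraction_dens_ne_zero {p : Stream'.Seq (ℝ × ℝ)} (hp : p ∈ WallParameters) {z : ℂ}
    (hz : 0 < z.im) (n : ℕ) : (wallFraction p z).dens n ≠ 0 := by
  induction n with
  | zero => exact (wallFraction_dens_ratio hp hz 0 (g' := 0) rfl).1
  | succ n ih =>
    rcases n with _ | n
    · exact (wallFraction_dens_ratio hp hz 0 (g' := 0) rfl).2.1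
    · rcases h : p.get? n with _ | x
      · rw [GenContFract.dens_stable_of_terminated (Nat.le_succ (n + 1))
          (wallFraction_terminatedAt z h)]
        exact ih
      · exact (wallFraction_dens_ratio hp hz (n + 1) (g' := x.1)
          (by rw [shiftedFst_succ, h]; rfl)).2.1

/-- The value of the continued fraction whose tail after `n` steps is replaced by `X`,
in terms of the continuants. -/
lemma wallFraction_modified_approximant {p : Stream'.Seq (ℝ × ℝ)} (hp : p ∈ WallParameters) {z : ℂ}
    (hz : 0 < z.im) (n : ℕ) {g' : ℝ} (h : (shiftedFst p).get? n = some g') {X : ℂ}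
    (hX : 0 ≤ X.im) :
    ((wallFraction p z).nums (n + 1) - (1 - g') * (z - X) * (wallFraction p z).nums n) /
      ((wallFraction p z).dens (n + 1) - (1 - g') * (z - X) * (wallFraction p z).dens n) =
    -(wallTail p z n X)⁻¹ := by
  induction n generalizing g' X with
  | zero =>
    have h0 : g' = 0 := by simpa [shiftedFst, eq_comm] using h
    rw [wallFraction_nums_zero, wallFraction_nums_one, wallFraction_dens_one,
      GenContFract.zeroth_den_eq_one, h0]
    simp [wallTail, neg_div]
  | succ n ih =>
    rw [shiftedFst_succ, Option.map_eq_some_iff] at h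
    obtain ⟨⟨g, r⟩, hn, rfl⟩ := h
    obtain ⟨b, hb, hb1⟩ := exists_shiftedFst hp hn
    obtain ⟨hg, hg1⟩ := wallParameters_bounded hp n _ hn
    simp only at hg hg1 ⊢
    have hX' := im_pos_of_mem_pickDisc hz
      (wallStep_mem_pickDisc hz (wallParameters_bounded hp n) hX)
    rw [wallTail, ← ih hb hX'.le, hn,
      GenContFract.nums_recurrence (wallFraction_get?_succ z hb hn) rfl rfl,
      GenContFract.dens_recurrence (wallFraction_get?_succ z hb hn) rfl rfl]
    -- both fractions agree after multiplying numerator and denominator by the denominator of the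
    -- inserted step
    have hQ : z - r - (1 - g) * (z - X) ≠ 0 := wallStep_den_ne_zero hz hg hg1 hX
    have e (A B : ℂ) : (z - r) * A + -((1 - b) * g * (z ^ 2 + 1)) * B - (1 - g) * (z - X) * A =
        (z - r - (1 - g) * (z - X)) *
          (A - (1 - b) * (z - wallStep z (some (g, r)) X) * B) := by
      simp only [wallStep, sub_sub_cancel]
      rw [mul_sub (z - r - (1 - g) * (z - X)) A]
      have : (z - r - (1 - g) * (z - X)) *
          ((1 - b) * (g * (z ^ 2 + 1) / (z - r - (1 - g) * (z - X))) * B) =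
          (1 - b) * g * (z ^ 2 + 1) * B := by
        field_simp
      rw [this]
      ring
    simp only
    rw [e, e, mul_div_mul_left _ _ hQ]

lemma wallFraction_convs_succ {p : Stream'.Seq (ℝ × ℝ)} (hp : p ∈ WallParameters) {z : ℂ}
    (hz : 0 < z.im) (n : ℕ) : (wallFraction p z).convs (n + 1) = -(wallTail p z n z)⁻¹ := by
  have of_some (n : ℕ) {g' : ℝ} (h : (shiftedFst p).get? n = some g') :
      (wallFraction p z).convs (n + 1) = -(wallTail p z n z)⁻¹ := by
    simpa [GenContFract.conv_eq_num_div_den] using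
      wallFraction_modified_approximant hp hz n h hz.le
  induction n with
  | zero => exact of_some 0 (g' := 0) rfl
  | succ n ih =>
    rcases h : p.get? n with _ | x
    · rw [GenContFract.convs_stable_of_terminated (Nat.le_succ (n + 1))
        (wallFraction_terminatedAt z h), ih, wallTail, h]
      rfl
    · exact of_some (n + 1) (g' := x.1) (by rw [shiftedFst_succ, h]; rfl)

/-! ### Schwarz's lemma on the upper half-plane -/

/-- The Cayley transform from the upper half-plane to the unit disc. -/
noncomputable def toDisc (z : ℂ) : ℂ := (z - Complex.I) / (z + Complex.I)

/-- The inverse Cayley transform from the unit disc to the upper half-plane. -/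
noncomputable def ofDisc (w : ℂ) : ℂ := Complex.I * (1 + w) / (1 - w)

lemma add_I_ne_zero {z : ℂ} (hz : 0 < z.im) : z + Complex.I ≠ 0 := by
  intro h
  have := congrArg Complex.im h
  simp at this
  linarith

lemma norm_toDisc_lt_one {z : ℂ} (hz : 0 < z.im) : ‖toDisc z‖ < 1 := by
  rw [toDisc, norm_div, div_lt_one (norm_pos_iff.2 (add_I_ne_zero hz))]
  refine lt_of_pow_lt_pow_left₀ 2 (norm_nonneg _) ?_
  rw [Complex.sq_norm, Complex.sq_norm, Complex.normSq_apply, Complex.normSq_apply]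
  simp
  nlinarith

lemma one_sub_ne_zero_of_norm_lt {w : ℂ} (hw : ‖w‖ < 1) : 1 - w ≠ 0 := by
  intro h
  rw [sub_eq_zero] at h
  simp [← h] at hw

lemma ofDisc_toDisc {z : ℂ} (hz : 0 < z.im) : ofDisc (toDisc z) = z := by
  have h1 := add_I_ne_zero hz
  have h2 := one_sub_ne_zero_of_norm_lt (norm_toDisc_lt_one hz)
  unfold ofDisc
  rw [div_eq_iff h2, toDisc]
  field_simp
  ring

lemma ofDisc_im (w : ℂ) : (ofDisc w).im = (1 - ‖w‖ ^ 2) / Complex.normSq (1 - w) := by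
  rw [ofDisc, Complex.div_im, Complex.sq_norm, Complex.normSq_apply w]
  simp
  ring

lemma ofDisc_im_pos {w : ℂ} (hw : ‖w‖ < 1) : 0 < (ofDisc w).im := by
  rw [ofDisc_im]
  refine div_pos ?_ (Complex.normSq_pos.2 (one_sub_ne_zero_of_norm_lt hw))
  nlinarith [norm_nonneg w]

/-- In disc coordinates `pickMap z` is multiplication by `toDisc z`. -/
lemma pickMap_ofDisc {z w : ℂ} (hw : 1 - w ≠ 0) (hz : 0 < z.im) :
    pickMap z (ofDisc w) = ofDisc (toDisc z * w) := by
  have h1 := add_I_ne_zero hz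
  have e1 : z * ofDisc w - 1 = Complex.I * (z + Complex.I + (z - Complex.I) * w) / (1 - w) := by
    unfold ofDisc; field_simp; ring_nf; simp; ring
  have e2 : ofDisc w + z = (z + Complex.I - (z - Complex.I) * w) / (1 - w) := by
    unfold ofDisc; field_simp; ring
  have e3 : 1 + toDisc z * w = (z + Complex.I + (z - Complex.I) * w) / (z + Complex.I) := by
    unfold toDisc; field_simp
  have e4 : 1 - toDisc z * w = (z + Complex.I - (z - Complex.I) * w) / (z + Complex.I) := by
    unfold toDisc; field_simp
  rw [pickMap, e1, e2, div_div_div_cancel_right₀ hw, ofDisc, e3, e4, mul_div_assoc',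
    div_div_div_cancel_right₀ h1]

/-- Holomorphic self-maps of the upper half-plane that fix `i`, as functions on `ℂ` with arbitrary
values outside the upper half-plane. -/
def FixingI : Set (ℂ → ℂ) :=
  {χ | DifferentiableOn ℂ χ {z | 0 < z.im} ∧ (∀ z : ℂ, 0 < z.im → 0 < (χ z).im) ∧
    χ Complex.I = Complex.I}

lemma id_mem_fixingI : id ∈ FixingI := ⟨differentiableOn_id, fun _ h => h, rfl⟩

/-- Schwarz's lemma: a self-map fixing `i`, other than the identity, factors through `pickMap`.
In disc coordinates it is `w ↦ w f(w)` with `|f| < 1` everywhere or `f` a constant on the unit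
circle. -/
lemma exists_eq_pickMap {χ : ℂ → ℂ} (hχ : χ ∈ FixingI) (hne : ∃ z : ℂ, 0 < z.im ∧ χ z ≠ z) :
    ∃ T : ℂ → ℂ, DifferentiableOn ℂ T {z | 0 < z.im} ∧
      ((∀ z : ℂ, 0 < z.im → 0 < (T z).im) ∨ ∃ c : ℝ, ∀ z, T z = c) ∧
      ∀ z : ℂ, 0 < z.im → χ z = pickMap z (T z) := by
  obtain ⟨hd, him, hI⟩ := hχ
  set s : ℂ → ℂ := fun w => toDisc (χ (ofDisc w)) with hs
  have mem {w : ℂ} (hw : w ∈ Metric.ball (0 : ℂ) 1) : ‖w‖ < 1 := by simpa using hw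
  have hball {z : ℂ} (hz : 0 < z.im) : toDisc z ∈ Metric.ball (0 : ℂ) 1 := by
    simpa using norm_toDisc_lt_one hz
  have hofd : DifferentiableOn ℂ ofDisc (Metric.ball 0 1) := by
    unfold ofDisc
    exact DifferentiableOn.div (by fun_prop) (by fun_prop)
      fun w hw => one_sub_ne_zero_of_norm_lt (mem hw)
  have htod : DifferentiableOn ℂ toDisc {z | 0 < z.im} := by
    unfold toDisc
    exact DifferentiableOn.div (by fun_prop) (by fun_prop) fun z hz => add_I_ne_zero hz
  have hofm : Set.MapsTo ofDisc (Metric.ball 0 1) {z | 0 < z.im} :=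
    fun w hw => ofDisc_im_pos (mem hw)
  have hsd : DifferentiableOn ℂ s (Metric.ball 0 1) :=
    htod.comp (hd.comp hofd hofm) fun w hw => him _ (hofm hw)
  have hs0 : s 0 = 0 := by simp [hs, ofDisc, toDisc, hI]
  have hmaps : Set.MapsTo s (Metric.ball 0 1) (Metric.closedBall (s 0) 1) := by
    intro w hw
    rw [hs0]
    simpa using (norm_toDisc_lt_one (him _ (hofm hw))).le
  have hsχ {z : ℂ} (hz : 0 < z.im) : χ z = ofDisc (s (toDisc z)) := by
    rw [hs]
    simp only
    rw [ofDisc_toDisc hz, ofDisc_toDisc (him z hz)]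
  by_cases h1 : ∃ w ∈ Metric.ball (0 : ℂ) 1, ‖dslope s 0 w‖ = 1
  · obtain ⟨C, hC, hCeq⟩ := Complex.affine_of_mapsTo_ball_of_exists_norm_dslope_eq_div' hsd hmaps
      (by simpa using h1)
    have hC1 : 1 - C ≠ 0 := by
      intro h
      obtain ⟨z, hz, hzne⟩ := hne
      refine hzne ?_
      rw [hsχ hz, hCeq (hball hz), hs0, ← sub_eq_zero.1 h]
      simpa using ofDisc_toDisc hz
    have hCim : (ofDisc C).im = 0 := by
      rw [ofDisc_im, hC]; simp
    have hre : ofDisc C = ((ofDisc C).re : ℂ) := Complex.ext rfl (by simpa using hCim)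
    refine ⟨fun _ => ofDisc C, differentiableOn_const _, Or.inr ⟨_, fun _ => hre⟩, fun z hz => ?_⟩
    rw [pickMap_ofDisc hC1 hz, hsχ hz, hCeq (hball hz), hs0]
    simp
  · have hlt (w : ℂ) (hw : w ∈ Metric.ball (0 : ℂ) 1) : ‖dslope s 0 w‖ < 1 := by
      refine lt_of_le_of_ne ?_ fun h => h1 ⟨w, hw, h⟩
      simpa using Complex.norm_dslope_le_div_of_mapsTo_ball hsd hmaps hw
    have hfd : DifferentiableOn ℂ (dslope s 0) (Metric.ball 0 1) :=
      (Complex.differentiableOn_dslope (Metric.ball_mem_nhds 0 one_pos)).2 hsd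
    refine ⟨fun z => ofDisc (dslope s 0 (toDisc z)), ?_, Or.inl fun z hz => ?_, fun z hz => ?_⟩
    · exact hofd.comp (hfd.comp htod fun z hz => hball hz)
        fun z hz => by simpa using hlt _ (hball hz)
    · exact ofDisc_im_pos (hlt _ (hball hz))
    · rw [pickMap_ofDisc (one_sub_ne_zero_of_norm_lt (hlt _ (hball hz))) hz, hsχ hz]
      have := sub_smul_dslope s 0 (toDisc z)
      rw [hs0, sub_zero, sub_zero, smul_eq_mul] at this
      rw [this]

/-- One step of the Schur algorithm for self-maps of the upper half-plane that fix `i`. -/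
lemma exists_eq_wallStep {χ : ℂ → ℂ} (hχ : χ ∈ FixingI) (hne : ∃ z : ℂ, 0 < z.im ∧ χ z ≠ z) :
    ∃ y : (ℝ × ℝ) × FixingI, 0 < y.1.1 ∧
      (y.1.1 < 1 ∨ (y.1.1 = 1 ∧ ∀ z : ℂ, 0 < z.im → y.2.1 z = z)) ∧
      ∀ z : ℂ, 0 < z.im → χ z = wallStep z (some y.1) (y.2.1 z) := by
  obtain ⟨T, hTd, hT | ⟨c, hc⟩, hTe⟩ := exists_eq_pickMap hχ hne
  · have hI : 0 < Complex.I.im := by simp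
    have ht := hT _ hI
    set t := (T Complex.I).im with ht_def
    -- `(g, r)` and the remainder are determined by `T = ((1 - g) χ' - r) / g` and `χ' i = i`
    have hχ' : (fun z => (T z - (T Complex.I).re) / t) ∈ FixingI := by
      refine ⟨(hTd.sub_const _).div_const _, fun z hz => ?_, ?_⟩
      · rw [Complex.div_ofReal_im]
        have := hT z hz
        simp only [Complex.sub_im, Complex.ofReal_im, sub_zero]
        positivity
      · have : (t : ℂ) ≠ 0 := by exact_mod_cast ht.ne'
        simp only
        rw [div_eq_iff this]
        apply Complex.ext <;> simp [ht_def]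
    have hg1 : 1 / (1 + t) < 1 := by rw [div_lt_one (by positivity)]; linarith
    have hg : 0 < 1 / (1 + t) := by positivity
    refine ⟨⟨(1 / (1 + t), -((T Complex.I).re / (1 + t))), ⟨_, hχ'⟩⟩, hg, Or.inl hg1,
      fun z hz => ?_⟩
    rw [wallStep_some hz hg hg1.le (hχ'.2.1 z hz).le, hTe z hz]
    congr 1
    have h1 : (t : ℂ) ≠ 0 := by exact_mod_cast ht.ne'
    have h2 : (1 + t : ℂ) ≠ 0 := by exact_mod_cast (by positivity : 1 + t ≠ 0)
    push_cast
    field_simp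
    ring
  · refine ⟨⟨(1, -c), ⟨id, id_mem_fixingI⟩⟩, one_pos, Or.inr ⟨rfl, fun _ _ => rfl⟩, fun z hz => ?_⟩
    change χ z = wallStep z (some (1, -c)) z
    rw [wallStep_some hz one_pos le_rfl hz.le, hTe z hz, hc]
    simp

open Classical in
/-- One step of the expansion: the first pair and the remainder, or `none` for the identity. -/
noncomputable def wallNext (χ : FixingI) : Option ((ℝ × ℝ) × FixingI) :=
  if h : ∃ z : ℂ, 0 < z.im ∧ χ.1 z ≠ z then some (exists_eq_wallStep χ.2 h).choose else none

/-- The sequence of pairs produced by the Schur algorithm. -/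
noncomputable def wallExpansion (χ : FixingI) : Stream'.Seq (ℝ × ℝ) :=
  Stream'.Seq.corec wallNext χ

lemma wallExpansion_cases (χ : FixingI) :
    ((∀ z : ℂ, 0 < z.im → χ.1 z = z) ∧ wallExpansion χ = Stream'.Seq.nil) ∨
    ∃ (x : ℝ × ℝ) (χ' : FixingI), 0 < x.1 ∧
      (x.1 < 1 ∨ (x.1 = 1 ∧ ∀ z : ℂ, 0 < z.im → χ'.1 z = z)) ∧
      (∀ z : ℂ, 0 < z.im → χ.1 z = wallStep z (some x) (χ'.1 z)) ∧
      wallExpansion χ = Stream'.Seq.cons x (wallExpansion χ') := by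
  by_cases h : ∃ z : ℂ, 0 < z.im ∧ χ.1 z ≠ z
  · obtain ⟨h1, h2, h3⟩ := (exists_eq_wallStep χ.2 h).choose_spec
    exact Or.inr ⟨_, _, h1, h2, h3, Stream'.Seq.corec_cons (by rw [wallNext, dif_pos h])⟩
  · refine Or.inl ⟨by simpa using h, Stream'.Seq.corec_nil _ _ (by rw [wallNext, dif_neg h])⟩

lemma wallExpansion_eq_nil {χ : FixingI} (h : ∀ z : ℂ, 0 < z.im → χ.1 z = z) :
    wallExpansion χ = Stream'.Seq.nil :=
  Stream'.Seq.corec_nil _ _ (by rw [wallNext, dif_neg (by simpa using h)])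

lemma wallExpansion_mem (χ : FixingI) : wallExpansion χ ∈ WallParameters := by
  intro n
  induction n generalizing χ with
  | zero =>
    intro g r hgr
    rcases wallExpansion_cases χ with ⟨-, h⟩ | ⟨x, χ', h0, h1, -, h⟩
    · simp [h] at hgr
    · rw [h, Stream'.Seq.get?_cons_zero, Option.some_inj] at hgr
      subst hgr
      refine ⟨h0, h1.imp_right fun ⟨h2, h3⟩ => ⟨h2, ?_⟩⟩
      rw [h, wallExpansion_eq_nil h3]
      rfl
  | succ n ih =>
    intro g r hgr
    rcases wallExpansion_cases χ with ⟨-, h⟩ | ⟨x, χ', -, -, -, h⟩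
    · simp [h] at hgr
    · rw [h, Stream'.Seq.get?_cons_succ] at hgr
      rw [h]
      exact ih χ' g r hgr

lemma exists_eq_wallTail_wallExpansion (χ : FixingI) {z : ℂ} (hz : 0 < z.im) (n : ℕ) :
    ∃ X ∈ pickDisc z, χ.1 z = wallTail (wallExpansion χ) z n X := by
  induction n generalizing χ with
  | zero =>
    refine ⟨_, ?_, rfl⟩
    rcases wallExpansion_cases χ with ⟨h, -⟩ | ⟨x, χ', h0, h1, h, -⟩
    · rw [h z hz]
      exact self_mem_pickDisc z
    · rw [h z hz]
      refine wallStep_mem_pickDisc hz ?_ (χ'.2.2.1 z hz).le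
      rintro _ ⟨⟩
      exact ⟨h0, h1.elim le_of_lt fun h => h.1.le⟩
  | succ n ih =>
    rcases wallExpansion_cases χ with ⟨h1, h⟩ | ⟨x, χ', -, -, h1, h⟩
    · refine ⟨z, self_mem_pickDisc z, ?_⟩
      rw [h1 z hz, h, wallTail_succ', Stream'.Seq.get?_nil]
      rfl
    · obtain ⟨X, hX, hX'⟩ := ih χ'
      refine ⟨X, hX, ?_⟩
      rw [h, wallTail_succ', Stream'.Seq.get?_cons_zero, Stream'.Seq.tail_cons, ← hX', h1 z hz]

/-- A self-map of the upper half-plane fixing `i` is the value of its own expansion. -/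
lemma wallLimit_wallExpansion (χ : FixingI) {z : ℂ} (hz : 0 < z.im) :
    wallLimit (wallExpansion χ) z = χ.1 z := by
  have hp := wallParameters_bounded (wallExpansion_mem χ)
  refine tendsto_nhds_unique (tendsto_wallTail hp hz) (tendsto_iff_norm_sub_tendsto_zero.2 ?_)
  refine squeeze_zero (fun _ => norm_nonneg _) (fun n => ?_) (by
    simpa using (tendsto_pow_atTop_nhds_zero_of_lt_one (pickRate_nonneg z)
      (pickRate_lt_one hz)).const_mul (2 * pickBound z))
  obtain ⟨X, hX, h⟩ := exists_eq_wallTail_wallExpansion χ hz n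
  rw [h]
  exact norm_wallTail_sub_le hp hz (self_mem_pickDisc z) hX n

/-! ### Uniqueness of the expansion and the bijection -/

lemma pickMap_ne_self {z T : ℂ} (hz : 0 < z.im) (hzI : z ^ 2 + 1 ≠ 0) (hT : 0 ≤ T.im) :
    pickMap z T ≠ z := by
  intro h
  rw [pickMap, div_eq_iff (add_ne_zero_of_im hz hT)] at h
  exact hzI (by linear_combination -h)

lemma pickMap_injective {z T T' : ℂ} (hz : 0 < z.im) (hzI : z ^ 2 + 1 ≠ 0) (hT : 0 ≤ T.im)
    (hT' : 0 ≤ T'.im) (h : pickMap z T = pickMap z T') : T = T' := by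
  rw [pickMap, pickMap, div_eq_div_iff (add_ne_zero_of_im hz hT) (add_ne_zero_of_im hz hT')] at h
  have : (z ^ 2 + 1) * (T - T') = 0 := by linear_combination h
  exact sub_eq_zero.1 ((mul_eq_zero.1 this).resolve_left hzI)

lemma sq_add_one_ne_zero {z : ℂ} (hz : 0 < z.im) (hzI : z ≠ Complex.I) : z ^ 2 + 1 ≠ 0 := by
  have : z ^ 2 + 1 = (z - Complex.I) * (z + Complex.I) := by ring_nf; simp; ring
  rw [this]
  exact mul_ne_zero (sub_ne_zero.2 hzI) (add_I_ne_zero hz)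

lemma wallParameters_tail {p : Stream'.Seq (ℝ × ℝ)} (hp : p ∈ WallParameters) :
    p.tail ∈ WallParameters := by
  intro n g r h
  rw [Stream'.Seq.get?_tail] at h
  simpa only [Stream'.Seq.TerminatedAt, Stream'.Seq.get?_tail] using hp (n + 1) g r h

lemma differentiableOn_wallLimit {p : Stream'.Seq (ℝ × ℝ)} (hp : WallBounded p) :
    DifferentiableOn ℂ (wallLimit p) {z | 0 < z.im} := by
  have h := (differentiableOn_inv_wallLimit hp).inv fun z hz h => by
    have := wallLimit_im_pos hp hz
    rw [neg_eq_zero, inv_eq_zero] at h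
    simp [h] at this
  exact h.neg.congr fun z _ => by simp

lemma wallLimit_ne_self {p : Stream'.Seq (ℝ × ℝ)} (hp : WallBounded p) {x : ℝ × ℝ}
    (h : p.get? 0 = some x) {z : ℂ} (hz : 0 < z.im) (hzI : z ≠ Complex.I) : wallLimit p z ≠ z := by
  obtain ⟨g, r⟩ := x
  obtain ⟨hg, hg1⟩ := hp 0 _ h
  have hL := (wallLimit_im_pos hp.tail hz).le
  rw [wallLimit_eq_wallStep hp hz, h, wallStep_some hz hg hg1 hL]
  exact pickMap_ne_self hz (sq_add_one_ne_zero hz hzI) (affine_im_nonneg hg hg1 hL)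

/-- The value determines the first pair and, unless the sequence ends there, the value of
the tail. -/
lemma wallLimit_first_pair {p q : Stream'.Seq (ℝ × ℝ)} (hp : WallBounded p) (hq : WallBounded q)
    (h : ∀ z : ℂ, 0 < z.im → wallLimit p z = wallLimit q z) {g r g' r' : ℝ}
    (hgr : p.get? 0 = some (g, r)) (hgr' : q.get? 0 = some (g', r')) :
    g = g' ∧ r = r' ∧
      (g < 1 → ∀ z : ℂ, 0 < z.im → wallLimit p.tail z = wallLimit q.tail z) := by
  obtain ⟨hg, hg1⟩ := hp 0 _ hgr
  obtain ⟨hg', hg1'⟩ := hq 0 _ hgr'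
  simp only at hg hg1 hg' hg1'
  have hgC : (g : ℂ) ≠ 0 := by exact_mod_cast hg.ne'
  have hgC' : (g' : ℂ) ≠ 0 := by exact_mod_cast hg'.ne'
  have key (z : ℂ) (hz : 0 < z.im) (hzI : z ≠ Complex.I) :
      ((1 - g) * wallLimit p.tail z - r) / g = ((1 - g') * wallLimit q.tail z - r') / g' := by
    have hL := (wallLimit_im_pos hp.tail hz).le
    have hL' := (wallLimit_im_pos hq.tail hz).le
    have := h z hz
    rw [wallLimit_eq_wallStep hp hz, wallLimit_eq_wallStep hq hz, hgr, hgr',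
      wallStep_some hz hg hg1 hL, wallStep_some hz hg' hg1' hL'] at this
    exact pickMap_injective hz (sq_add_one_ne_zero hz hzI) (affine_im_nonneg hg hg1 hL)
      (affine_im_nonneg hg' hg1' hL') this
  have hopen : {z : ℂ | 0 < z.im} ∈ 𝓝 Complex.I :=
    (isOpen_lt continuous_const Complex.continuous_im).mem_nhds (by simp)
  -- the step is degenerate at `i`, where the identity follows by continuity
  have keyI : ((1 - g) * Complex.I - r) / g = ((1 - g') * Complex.I - r') / (g' : ℂ) := by
    have hc := ((differentiableOn_wallLimit hp.tail).differentiableAt hopen).continuousAt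
    have hc' := ((differentiableOn_wallLimit hq.tail).differentiableAt hopen).continuousAt
    have t1 : Filter.Tendsto (fun z => ((1 - g) * wallLimit p.tail z - r) / g) (𝓝[≠] Complex.I)
        (𝓝 (((1 - g) * wallLimit p.tail Complex.I - r) / g)) :=
      ((hc.const_mul _).sub_const _ |>.div_const _).mono_left nhdsWithin_le_nhds
    have t2 : Filter.Tendsto (fun z => ((1 - g') * wallLimit q.tail z - r') / g')
        (𝓝[≠] Complex.I) (𝓝 (((1 - g') * wallLimit q.tail Complex.I - r') / g')) :=
      ((hc'.const_mul _).sub_const _ |>.div_const _).mono_left nhdsWithin_le_nhds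
    rw [wallLimit_I hp.tail] at t1
    rw [wallLimit_I hq.tail] at t2
    refine tendsto_nhds_unique_of_eventuallyEq t1 t2 ?_
    filter_upwards [mem_nhdsWithin_of_mem_nhds hopen, self_mem_nhdsWithin] with z hz hzI
      using key z hz hzI
  have him := congrArg Complex.im keyI
  have hre := congrArg Complex.re keyI
  rw [Complex.div_ofReal_im, Complex.div_ofReal_im] at him
  rw [Complex.div_ofReal_re, Complex.div_ofReal_re] at hre
  simp at him hre
  have e1 : g = g' := by
    field_simp at him
    linarith
  subst e1
  have e2 : r = r' := by
    field_simp at hre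
    linarith
  subst e2
  refine ⟨rfl, rfl, fun hlt z hz => ?_⟩
  rcases eq_or_ne z Complex.I with rfl | hzI
  · rw [wallLimit_I hp.tail, wallLimit_I hq.tail]
  · have h1 := key z hz hzI
    have h2 : (1 - g : ℂ) ≠ 0 := by exact_mod_cast (by linarith : (1 - g : ℝ) ≠ 0)
    rw [div_left_inj' hgC, sub_left_inj] at h1
    exact mul_left_cancel₀ h2 h1

/-- The value of the expansion determines the sequence. -/
lemma wallLimit_injective {p q : Stream'.Seq (ℝ × ℝ)} (hp : p ∈ WallParameters)
    (hq : q ∈ WallParameters) (h : ∀ z : ℂ, 0 < z.im → wallLimit p z = wallLimit q z) : p = q := by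
  have hz : 0 < (2 * Complex.I).im := by simp
  have hzI : 2 * Complex.I ≠ Complex.I := fun h => by simpa using congrArg Complex.im h
  have limit_nil {p : Stream'.Seq (ℝ × ℝ)} (hp : p ∈ WallParameters) (h : p.get? 0 = none) :
      wallLimit p (2 * Complex.I) = 2 * Complex.I := by
    rw [wallLimit_eq_wallStep (wallParameters_bounded hp) hz, h]
    rfl
  ext1 n
  induction n generalizing p q with
  | zero =>
    rcases hp0 : p.get? 0 with _ | ⟨g, r⟩ <;> rcases hq0 : q.get? 0 with _ | ⟨g', r'⟩
    · rfl
    · exact absurd (h _ hz ▸ limit_nil hp hp0)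
        (wallLimit_ne_self (wallParameters_bounded hq) hq0 hz hzI)
    · exact absurd (h _ hz ▸ limit_nil hq hq0)
        (wallLimit_ne_self (wallParameters_bounded hp) hp0 hz hzI)
    · obtain ⟨rfl, rfl, -⟩ := wallLimit_first_pair (wallParameters_bounded hp)
        (wallParameters_bounded hq) h hp0 hq0
      rfl
  | succ n ih =>
    rcases hp0 : p.get? 0 with _ | ⟨g, r⟩ <;> rcases hq0 : q.get? 0 with _ | ⟨g', r'⟩
    · rw [p.le_stable (Nat.zero_le _) hp0, q.le_stable (Nat.zero_le _) hq0]
    · exact absurd (h _ hz ▸ limit_nil hp hp0)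
        (wallLimit_ne_self (wallParameters_bounded hq) hq0 hz hzI)
    · exact absurd (h _ hz ▸ limit_nil hq hq0)
        (wallLimit_ne_self (wallParameters_bounded hp) hp0 hz hzI)
    · obtain ⟨rfl, rfl, htail⟩ := wallLimit_first_pair (wallParameters_bounded hp)
        (wallParameters_bounded hq) h hp0 hq0
      rcases hp 0 g r hp0 with ⟨-, hlt | ⟨h1, hterm⟩⟩
      · rw [← Stream'.Seq.get?_tail, ← Stream'.Seq.get?_tail]
        exact ih (wallParameters_tail hp) (wallParameters_tail hq) (htail hlt)
      · obtain ⟨-, hlt | ⟨-, hterm'⟩⟩ := hq 0 g r hq0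
        · exact absurd h1 hlt.ne
        · rw [p.le_stable (by omega : 0 + 1 ≤ n + 1) hterm,
            q.le_stable (by omega : 0 + 1 ≤ n + 1) hterm']

lemma neg_inv_im_pos {X : ℂ} (hX : 0 < X.im) : 0 < (-X⁻¹).im := by
  have : 0 < Complex.normSq X := Complex.normSq_pos.2 fun h => by simp [h] at hX
  rw [Complex.neg_im, Complex.inv_im, neg_div, neg_neg]
  positivity

/-- The Nevanlinna function given by an admissible sequence. -/
noncomputable def wallValue (p : WallParameters) : NormalizedNevanlinna :=
  ⟨fun z => -(wallLimit p.1 z)⁻¹, by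
    have hp := wallParameters_bounded p.2
    refine ⟨UpperHalfPlane.mdifferentiable_iff.2 ?_,
      fun z => neg_inv_im_pos (wallLimit_im_pos hp z.im_pos), ?_⟩
    · refine (differentiableOn_inv_wallLimit hp).congr fun z hz => ?_
      rw [UpperHalfPlane.comp_ofComplex_of_im_pos _ z hz]
    · simp [wallLimit_I hp]⟩

lemma neg_inv_mem_fixingI (φ : NormalizedNevanlinna) :
    (fun z => -(φ.1 (UpperHalfPlane.ofComplex z))⁻¹) ∈ FixingI := by
  obtain ⟨φ, hd, him, hI⟩ := φ
  refine ⟨((UpperHalfPlane.mdifferentiable_iff.1 hd).inv fun z _ h => ?_).neg,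
    fun z _ => neg_inv_im_pos (him _), ?_⟩
  · have := him (UpperHalfPlane.ofComplex z)
    simp only [Function.comp_apply] at h
    simp [h] at this
  · have : UpperHalfPlane.ofComplex Complex.I = UpperHalfPlane.I :=
      UpperHalfPlane.ofComplex_apply UpperHalfPlane.I
    simp only [this, hI]
    simp

lemma wallValue_bijective : Function.Bijective wallValue := by
  constructor
  · intro p q hpq
    refine Subtype.ext (wallLimit_injective p.2 q.2 fun z hz => ?_)
    have := congrFun (congrArg Subtype.val hpq) ⟨z, hz⟩
    simpa [wallValue] using this
  · intro φ
    refine ⟨⟨_, wallExpansion_mem ⟨_, neg_inv_mem_fixingI φ⟩⟩, Subtype.ext (funext fun z => ?_)⟩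
    simp only [wallValue]
    rw [wallLimit_wallExpansion _ z.im_pos]
    simp [UpperHalfPlane.ofComplex_apply]

lemma wallLimit_of_terminatedAt {p : Stream'.Seq (ℝ × ℝ)} (hp : WallBounded p) {n : ℕ}
    (h : p.TerminatedAt n) {z : ℂ} (hz : 0 < z.im) : wallLimit p z = wallTail p z n z := by
  refine tendsto_nhds_unique (tendsto_wallTail hp hz) (tendsto_const_nhds.congr' ?_)
  filter_upwards [Filter.eventually_ge_atTop n] with m hm
  induction m, hm using Nat.le_induction with
  | base => rfl
  | succ m hm ih => rw [ih, wallTail, p.le_stable hm h]; rfl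

lemma tendstoLocallyUniformly_wallFraction (p : WallParameters) :
    TendstoLocallyUniformly (fun (n : ℕ) (z : ℍ) => (wallFraction p.1 z).convs n)
      (wallValue p).1 Filter.atTop := by
  have h := (tendstoLocallyUniformlyOn_inv_wallTail (wallParameters_bounded p.2)).comp
    (fun z : ℍ => (z : ℂ)) (t := Set.univ) (fun z _ => z.im_pos)
    UpperHalfPlane.continuous_coe.continuousOn
  rw [tendstoLocallyUniformlyOn_univ] at h
  intro u hu x
  obtain ⟨t, ht, hn⟩ := h u hu x
  refine ⟨t, ht, ?_⟩
  rw [← Filter.map_add_atTop_eq_nat 1, Filter.eventually_map]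
  filter_upwards [hn] with n hn y hy
  rw [wallFraction_convs_succ p.2 y.im_pos]
  exact hn y hy

theorem mainTheorem2 :
    -- no approximant has a vanishing denominator in the upper half-plane
    (∀ p ∈ WallParameters, ∀ (z : ℍ) (n : ℕ), (wallFraction p z).dens n ≠ 0) ∧
    -- the continued fraction defines a bijection
    ∃ Φ : WallParameters → NormalizedNevanlinna, Function.Bijective Φ ∧
      -- a sequence of length at most `n` goes to the value of its terminating continued fraction
      (∀ (p : WallParameters) (n : ℕ), p.1.TerminatedAt n →
        ∀ z : ℍ, (Φ p).1 z = (wallFraction p.1 z).convs (n + 1)) ∧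
      -- an infinite sequence goes to the locally uniform limit of its approximants
      (∀ p : WallParameters, ¬ p.1.Terminates →
        TendstoLocallyUniformly (fun (n : ℕ) (z : ℍ) => (wallFraction p.1 z).convs n)
          (Φ p).1 Filter.atTop) := by
  refine ⟨fun p hp z n => wallFraction_dens_ne_zero hp z.im_pos n, wallValue, wallValue_bijective,
    fun p n hn z => ?_, fun p _ => tendstoLocallyUniformly_wallFraction p⟩
  rw [wallFraction_convs_succ p.2 z.im_pos]
  simp only [wallValue]
  rw [wallLimit_of_terminatedAt (wallParameters_bounded p.2) hn z.im_pos]
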